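/- Consider a chain of $n$ sites, each of local dimension $2^q$, so that $\mathcal H=\bigotimes_{i=1}^n\mathbb C^{2^q}$, with a nearest-neighbour Hamiltonian $H=\sum_{b=1}^{n-1}H_{b,b+1}$ with open boundary, where each $H_{b,b+1}$ is Hermitian, acts on the sites $b,b+1$, and satisfies $\|H_{b,b+1}\|\le 1$. For $\beta\ge 0$ let $\rho=e^{-\beta H}/\mathrm{Tr}[e^{-\beta H}]$, let $\langle X,Y\rangle_\rho=\mathrm{Tr}[X^\dagger\rho^{1/2}Y\rho^{1/2}]$ be the KMS inner product on $\mathcal B(\mathcal H)$, and $\|X\|_\rho=\langle X,X\rangle_\rho^{1/2}$. For a subset $R\subseteq[n]$ with complement $\bar R$, let $$\tilde{\mathbb E}_R[X]=\sum_i\langle B^i,X\rangle_\rho\,B^i,$$ where $(B^i)_i$ is any basis, orthonormal for $\langle\cdot,\cdot\rangle_\rho$, of the space $\mathcal B(\mathcal H_{\bar R})$ of operators supported on $\bar R$ (the result does not depend on the basis), and let $\mathsf{Var}_R(X)=\|X-\tilde{\mathbb E}_R[X]\|_\rho^2$. Let $$\mathcal K_R[X]=\sum_{A}\Big([A,X]\,\big(\rho^{1/2}A^\dagger\rho^{-1/2}\big)-\big(\rho^{-1/2}A^\dagger\rho^{1/2}\big)\,[A,X]\Big),$$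 the sum being over all single-site Pauli strings $A$ on sites of $R$, that is, over all operators which act on one site $i\in R$ as an element of $\{I,\sigma_x,\sigma_y,\sigma_z\}^{\otimes q}$ (a tensor product of $q$ Pauli matrices, identity included) and as the identity on the other sites. The conditional spectral gap of $\mathcal K_R$ is $$\lambda_R=\inf_{X\in\mathcal B(\mathcal H),\ \mathsf{Var}_R(X)\neq 0}\frac{\langle X,-\mathcal K_R[X]\rangle_\rho}{\mathsf{Var}_R(X)}\in[0,\infty],\qquad \inf\emptyset=+\infty .$$ Lemma ($\mathcal K_R$ is locally gapped). For every $\beta\ge 0$ there is a constant $c_\beta\ge 1$, depending only on $\beta$, such that for all $n$ and $q$, every Hamiltonian $H$ as above and every subset $R\subseteq[n]$, $$\lambda_R\ \ge\ \frac{1}{(c_\beta\cdot 2^q)^{|R|}} .$$ -/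

import Mathlib

open scoped ComplexOrder

namespace SpinChain

/-! ### The spin chain and its operators -/

/-- Computational basis of `⊗_{i=1}^n ℂ^{2^q}`: every one of the `n` sites carries `q` qubits. -/
abbrev Config (n q : ℕ) : Type := Fin n → Fin q → Fin 2

/-- The algebra `𝓑(𝓗)` of operators on the chain, written in the computational basis. -/
abbrev Op (n q : ℕ) : Type := Matrix (Config n q) (Config n q) ℂ

/-- The operators on the sites of `S` alone. -/
abbrev LocOp (n q : ℕ) (S : Finset (Fin n)) : Type :=
  Matrix (S → Fin q → Fin 2) (S → Fin q → Fin 2) ℂ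

/-- The embedding `Y ↦ Y ⊗ I` of the operators on `S` into the operators on the whole chain. -/
def localOp {n q : ℕ} (S : Finset (Fin n)) : LocOp n q S →ₗ[ℂ] Op n q where
  toFun Y := Matrix.of fun s t =>
    if ∀ j, j ∉ S → s j = t j then Y (fun j => s j) (fun j => t j) else 0
  map_add' Y Z := by
    ext s t
    simp only [Matrix.of_apply, Matrix.add_apply]
    split_ifs <;> simp
  map_smul' a Y := by
    ext s t
    simp only [Matrix.of_apply, Matrix.smul_apply, RingHom.id_apply]
    split_ifs <;> simp

/-- `𝓑(𝓗_S)`: the operators on the chain that are supported on `S`. -/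
def supportedOn {n q : ℕ} (S : Finset (Fin n)) : Submodule ℂ (Op n q) :=
  LinearMap.range (localOp S)

/-- A single-site operator `M`, placed at the site `i`. -/
def siteOp {n q : ℕ} (i : Fin n) (M : Matrix (Fin q → Fin 2) (Fin q → Fin 2) ℂ) : Op n q :=
  localOp {i} (Matrix.of fun s t =>
    M (s ⟨i, Finset.mem_singleton_self i⟩) (t ⟨i, Finset.mem_singleton_self i⟩))

/-! ### Pauli strings -/

/-- The matrices `I, X, Y, Z`. -/
noncomputable def pauli : Fin 4 → Matrix (Fin 2) (Fin 2) ℂ :=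
  ![1, !![0, 1; 1, 0], !![0, -Complex.I; Complex.I, 0], !![1, 0; 0, -1]]

/-- The `q`-qubit Pauli string `⊗_k pauli (P k)`. -/
noncomputable def pauliString {q : ℕ} (P : Fin q → Fin 4) :
    Matrix (Fin q → Fin 2) (Fin q → Fin 2) ℂ :=
  Matrix.of fun s t => ∏ k, pauli (P k) (s k) (t k)

/-- The single-site Pauli string `P` at the site `i`. -/
noncomputable def sitePauli {n q : ℕ} (i : Fin n) (P : Fin q → Fin 4) : Op n q :=
  siteOp i (pauliString P)

/-! ### One-dimensional Hamiltonians and Gibbs states -/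

open scoped Matrix.Norms.L2Operator in
/-- A nearest-neighbour Hamiltonian with open boundary on `n` sites of local dimension `2 ^ q`:
`link b` is the term between the sites `b` and `b + 1` (counted from `0`), it is Hermitian,
supported on these two sites, and its operator norm is at most one. -/
structure Hamiltonian1D (n q : ℕ) where
  link : Fin (n - 1) → Op n q
  isHermitian : ∀ b, (link b).IsHermitian
  supported : ∀ b : Fin (n - 1),
    link b ∈ supportedOn {(⟨b, by omega⟩ : Fin n), (⟨b + 1, by omega⟩ : Fin n)}
  norm_le : ∀ b, ‖link b‖ ≤ 1

/-- The Hamiltonian `H = ∑_b H_{b,b+1}`. -/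
def Hamiltonian1D.total {n q : ℕ} (H : Hamiltonian1D n q) : Op n q := ∑ b, H.link b

/-- The Gibbs state `e^{-βH} / Tr e^{-βH}`. -/
noncomputable def gibbs {n q : ℕ} (β : ℝ) (H : Hamiltonian1D n q) : Op n q :=
  (NormedSpace.exp (-(β : ℂ) • H.total)).trace⁻¹ • NormedSpace.exp (-(β : ℂ) • H.total)

theorem gibbs_posDef {n q : ℕ} (β : ℝ) (H : Hamiltonian1D n q) : (gibbs β H).PosDef := by
  have hT : H.total.IsHermitian := by
    unfold Hamiltonian1D.total Matrix.IsHermitian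
    rw [Matrix.conjTranspose_sum]
    exact Finset.sum_congr rfl fun b _ => H.isHermitian b
  have hA : (-((β / 2 : ℝ) : ℂ) • H.total).IsHermitian := by
    unfold Matrix.IsHermitian
    rw [Matrix.conjTranspose_smul, hT.eq]
    simp
  have hE : NormedSpace.exp (-(β : ℂ) • H.total)
      = NormedSpace.exp (-((β / 2 : ℝ) : ℂ) • H.total)
        * (NormedSpace.exp (-((β / 2 : ℝ) : ℂ) • H.total)).conjTranspose := by
    rw [hA.exp.eq, ← Matrix.exp_add_of_commute _ _ (Commute.refl _), ← add_smul]
    congr 2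
    push_cast
    ring
  have hP : (NormedSpace.exp (-(β : ℂ) • H.total)).PosDef := by
    have h0 : (NormedSpace.exp (-(β : ℂ) • H.total)).PosSemidef := by
      rw [hE]
      exact Matrix.posSemidef_self_mul_conjTranspose _
    exact h0.posDef_iff_isUnit.mpr (Matrix.isUnit_exp _)
  exact hP.smul (inv_pos.mpr hP.trace_pos)

/-! ### The KMS inner product -/

/-- The real power `ρ^s` of a positive definite matrix, by functional calculus. -/
noncomputable def matPow {n q : ℕ} (ρ : Op n q) (s : ℝ) : Op n q :=
  cfc (fun x : ℝ => x ^ s) ρ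

/-- `⟨X, Y⟩_ρ = Tr[X† ρ^{1/2} Y ρ^{1/2}]`. -/
noncomputable def kmsInner {n q : ℕ} (ρ X Y : Op n q) : ℂ :=
  (X.conjTranspose * matPow ρ (1 / 2) * Y * matPow ρ (1 / 2)).trace

/-- `‖X‖_ρ = ⟨X, X⟩_ρ^{1/2}`. -/
noncomputable def kmsNorm {n q : ℕ} (ρ X : Op n q) : ℝ := Real.sqrt (kmsInner ρ X X).re

/-- `B` is a KMS-orthonormal basis of `𝓑(𝓗_S)`. -/
structure IsKMSBasis {n q : ℕ} (ρ : Op n q) (S : Finset (Fin n)) {ι : Type*}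
    (B : ι → Op n q) : Prop where
  orthonormal_self : ∀ i, kmsInner ρ (B i) (B i) = 1
  orthonormal_ne : ∀ i j, i ≠ j → kmsInner ρ (B i) (B j) = 0
  span_eq : Submodule.span ℂ (Set.range B) = supportedOn S

theorem matPow_isHermitian {n q : ℕ} (ρ : Op n q) (s : ℝ) : (matPow ρ s).IsHermitian :=
  cfc_predicate (p := IsSelfAdjoint) _ ρ

theorem matPow_add {n q : ℕ} {ρ : Op n q} (hρ : ρ.PosDef) (s t : ℝ) :
    matPow ρ s * matPow ρ t = matPow ρ (s + t) := by
  have hsp : ∀ x ∈ spectrum ℝ ρ, 0 < x := fun x hx => by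
    rw [hρ.isHermitian.spectrum_real_eq_range_eigenvalues] at hx
    obtain ⟨i, rfl⟩ := hx
    exact hρ.eigenvalues_pos i
  have hc : ∀ s : ℝ, ContinuousOn (fun x : ℝ => x ^ s) (spectrum ℝ ρ) := fun s x hx =>
    (Real.continuousAt_rpow_const x s (Or.inl (hsp x hx).ne')).continuousWithinAt
  unfold matPow
  rw [← cfc_mul _ _ ρ (hc s) (hc t)]
  exact cfc_congr fun x hx => (Real.rpow_add (hsp x hx) s t).symm

theorem matPow_zero {n q : ℕ} {ρ : Op n q} (hρ : ρ.PosDef) : matPow ρ 0 = 1 := by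
  unfold matPow
  simp only [Real.rpow_zero]
  exact cfc_const_one ℝ ρ (ha := hρ.isHermitian)

theorem kmsInner_self_eq {n q : ℕ} {ρ : Op n q} (hρ : ρ.PosDef) (X : Op n q) :
    kmsInner ρ X X = ((matPow ρ (1 / 4) * X * matPow ρ (1 / 4)).conjTranspose
      * (matPow ρ (1 / 4) * X * matPow ρ (1 / 4))).trace := by
  have h : matPow ρ (1 / 2) = matPow ρ (1 / 4) * matPow ρ (1 / 4) := by
    rw [matPow_add hρ]; norm_num
  unfold kmsInner
  rw [h, Matrix.conjTranspose_mul, Matrix.conjTranspose_mul, (matPow_isHermitian ρ _).eq,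
    ← Matrix.mul_assoc, Matrix.trace_mul_comm]
  simp only [Matrix.mul_assoc]

/-- The KMS form of a positive definite `ρ` is an inner product. -/
noncomputable abbrev kmsCore {n q : ℕ} {ρ : Op n q} (hρ : ρ.PosDef) :
    InnerProductSpace.Core ℂ (Op n q) where
  inner X Y := kmsInner ρ X Y
  conj_inner_symm X Y := by
    change star (kmsInner ρ Y X) = kmsInner ρ X Y
    unfold kmsInner
    rw [← Matrix.trace_conjTranspose]
    simp only [Matrix.conjTranspose_mul, Matrix.conjTranspose_conjTranspose,
      (matPow_isHermitian ρ _).eq]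
    rw [Matrix.trace_mul_comm]
    simp only [Matrix.mul_assoc]
  re_inner_nonneg X := by
    change 0 ≤ (kmsInner ρ X X).re
    rw [kmsInner_self_eq hρ]
    exact (Complex.le_def.mp (Matrix.posSemidef_conjTranspose_mul_self _).trace_nonneg).1
  add_left X Y Z := by
    change kmsInner ρ (X + Y) Z = kmsInner ρ X Z + kmsInner ρ Y Z
    simp [kmsInner, Matrix.conjTranspose_add, Matrix.add_mul]
  smul_left X Y r := by
    change kmsInner ρ (r • X) Y = star r * kmsInner ρ X Y
    simp [kmsInner, Matrix.conjTranspose_smul]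
  definite X hX := by
    change kmsInner ρ X X = 0 at hX
    rw [kmsInner_self_eq hρ, Matrix.trace_conjTranspose_mul_self_eq_zero_iff] at hX
    have h1 : matPow ρ (-(1 / 4)) * matPow ρ (1 / 4) = 1 := by
      rw [matPow_add hρ, neg_add_cancel, matPow_zero hρ]
    have h2 : matPow ρ (1 / 4) * matPow ρ (-(1 / 4)) = 1 := by
      rw [matPow_add hρ, add_neg_cancel, matPow_zero hρ]
    calc X = (matPow ρ (-(1 / 4)) * matPow ρ (1 / 4)) * X
          * (matPow ρ (1 / 4) * matPow ρ (-(1 / 4))) := by rw [h1, h2]; simp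
      _ = matPow ρ (-(1 / 4)) * (matPow ρ (1 / 4) * X * matPow ρ (1 / 4))
          * matPow ρ (-(1 / 4)) := by simp only [Matrix.mul_assoc]
      _ = 0 := by rw [hX]; simp

theorem exists_kmsBasis {n q : ℕ} {ρ : Op n q} (hρ : ρ.PosDef) (S : Finset (Fin n)) :
    ∃ B : Fin (Module.finrank ℂ (supportedOn (q := q) S)) → Op n q, IsKMSBasis ρ S B := by
  let _ : NormedAddCommGroup (Op n q) := (kmsCore hρ).toNormedAddCommGroup
  let _ : InnerProductSpace ℂ (Op n q) := InnerProductSpace.ofCore (kmsCore hρ).toCore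
  let b := stdOrthonormalBasis ℂ (supportedOn (q := q) S)
  have hb : ∀ i j, kmsInner ρ (b i : Op n q) (b j) = if i = j then 1 else 0 := fun i j =>
    (orthonormal_iff_ite.mp b.orthonormal) i j
  refine ⟨fun i => (b i : Op n q), fun i => by simp [hb], fun i j h => by simp [hb, h], ?_⟩
  have h := congrArg (Submodule.map (supportedOn (q := q) S).subtype) b.toBasis.span_eq
  rw [Submodule.map_span, ← Set.range_comp, Submodule.map_top, Submodule.range_subtype] at h
  calc Submodule.span ℂ (Set.range fun i => (b i : Op n q))
      = Submodule.span ℂ (Set.range ((supportedOn (q := q) S).subtype ∘ b.toBasis)) := by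
        congr 2
    _ = supportedOn S := h

/-! ### Spectral conditional expectations -/

/-- `Y ↦ ∑_i ⟨B_i, Y⟩_ρ B_i`. -/
noncomputable def kmsExpansion {n q : ℕ} (ρ : Op n q) {ι : Type*} [Fintype ι]
    (B : ι → Op n q) (Y : Op n q) : Op n q :=
  ∑ i, kmsInner ρ (B i) Y • B i

/-- The spectral conditional expectation `𝔼_R[Y] = ∑_i ⟨B_i, Y⟩_ρ B_i`, where `(B_i)` is a
KMS-orthonormal basis of `𝓑(𝓗_{Rᶜ})`. By `condExp_eq` the choice of the basis is immaterial. -/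
noncomputable def condExp {n q : ℕ} {ρ : Op n q} (hρ : ρ.PosDef) (R : Finset (Fin n))
    (Y : Op n q) : Op n q :=
  kmsExpansion ρ (exists_kmsBasis hρ Rᶜ).choose Y

theorem kmsExpansion_spec {n q : ℕ} {ρ : Op n q} (S : Finset (Fin n))
    {ι : Type*} [Fintype ι] {B : ι → Op n q} (hB : IsKMSBasis ρ S B) (Y : Op n q) :
    kmsExpansion ρ B Y ∈ supportedOn S ∧
      ∀ Z ∈ supportedOn S, kmsInner ρ (Y - kmsExpansion ρ B Y) Z = 0 := by
  classical
  refine ⟨?_, fun Z hZ => ?_⟩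
  · rw [← hB.span_eq]
    exact Submodule.sum_mem _ fun i _ =>
      Submodule.smul_mem _ _ (Submodule.subset_span ⟨i, rfl⟩)
  · have hsym : ∀ X Z : Op n q, star (kmsInner ρ Z X) = kmsInner ρ X Z := fun X Z => by
      unfold kmsInner
      rw [← Matrix.trace_conjTranspose]
      simp only [Matrix.conjTranspose_mul, Matrix.conjTranspose_conjTranspose,
        (matPow_isHermitian ρ _).eq]
      rw [Matrix.trace_mul_comm]
      simp only [Matrix.mul_assoc]
    rw [← hB.span_eq] at hZ
    induction hZ using Submodule.span_induction with
    | mem x hx =>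
      obtain ⟨j, rfl⟩ := hx
      have hj : ∀ i, kmsInner ρ (B j) (B i) = if i = j then 1 else 0 := fun i => by
        by_cases h : i = j
        · subst h; simp [hB.orthonormal_self]
        · simp [h, hB.orthonormal_ne j i (Ne.symm h)]
      have h1 : kmsInner ρ (B j) (kmsExpansion ρ B Y) = kmsInner ρ (B j) Y := by
        have : kmsInner ρ (B j) (kmsExpansion ρ B Y)
            = ∑ i, kmsInner ρ (B i) Y * kmsInner ρ (B j) (B i) := by
          simp [kmsInner, kmsExpansion, Matrix.mul_sum, Matrix.sum_mul, Matrix.trace_sum]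
        rw [this]
        simp [hj]
      rw [← hsym]
      have h2 : kmsInner ρ (B j) (Y - kmsExpansion ρ B Y) = 0 := by
        have : kmsInner ρ (B j) (Y - kmsExpansion ρ B Y)
            = kmsInner ρ (B j) Y - kmsInner ρ (B j) (kmsExpansion ρ B Y) := by
          simp [kmsInner, Matrix.mul_sub, Matrix.sub_mul]
        rw [this, h1, sub_self]
      rw [h2, star_zero]
    | zero => simp [kmsInner]
    | add x y _ _ hx hy =>
      have : ∀ W, kmsInner ρ W (x + y) = kmsInner ρ W x + kmsInner ρ W y := fun W => by
        simp [kmsInner, Matrix.mul_add, Matrix.add_mul]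
      rw [this, hx, hy, add_zero]
    | smul a x _ hx =>
      have : ∀ W, kmsInner ρ W (a • x) = a * kmsInner ρ W x := fun W => by
        simp [kmsInner]
      rw [this, hx, mul_zero]

/-- Every KMS-orthonormal basis of `𝓑(𝓗_{Rᶜ})` gives the same conditional expectation. -/
theorem condExp_eq {n q : ℕ} {ρ : Op n q} (hρ : ρ.PosDef) (R : Finset (Fin n))
    {ι : Type*} [Fintype ι] {B : ι → Op n q} (hB : IsKMSBasis ρ Rᶜ B) (Y : Op n q) :
    condExp hρ R Y = kmsExpansion ρ B Y := by
  obtain ⟨h1, h2⟩ := kmsExpansion_spec Rᶜ (exists_kmsBasis hρ Rᶜ).choose_spec Y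
  obtain ⟨h3, h4⟩ := kmsExpansion_spec Rᶜ hB Y
  unfold condExp
  set U := kmsExpansion ρ (exists_kmsBasis hρ Rᶜ).choose Y
  set V := kmsExpansion ρ B Y
  have hm : U - V ∈ supportedOn Rᶜ := Submodule.sub_mem _ h1 h3
  have h0 : kmsInner ρ (U - V) (U - V) = 0 := by
    have : kmsInner ρ (U - V) (U - V)
        = kmsInner ρ (Y - V) (U - V) - kmsInner ρ (Y - U) (U - V) := by
      simp only [kmsInner, Matrix.conjTranspose_sub, Matrix.sub_mul, Matrix.trace_sub]
      ring
    rw [this, h2 _ hm, h4 _ hm, sub_zero]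
  exact sub_eq_zero.mp ((kmsCore hρ).definite _ h0)

/-- The conditional variance `Var_R(X) = ‖X - 𝔼_R[X]‖_ρ²`. -/
noncomputable def condVar {n q : ℕ} {ρ : Op n q} (hρ : ρ.PosDef) (R : Finset (Fin n))
    (X : Op n q) : ℝ :=
  kmsNorm ρ (X - condExp hρ R X) ^ 2

/-! ### The generator and its conditional spectral gap -/

/-- `𝓚_A[X] = [A, X] (ρ^{1/2} A† ρ^{-1/2}) - (ρ^{-1/2} A† ρ^{1/2}) [A, X]`. -/
noncomputable def auxGen {n q : ℕ} (ρ A X : Op n q) : Op n q :=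
  (A * X - X * A) * (matPow ρ (1 / 2) * A.conjTranspose * matPow ρ (-(1 / 2)))
    - (matPow ρ (-(1 / 2)) * A.conjTranspose * matPow ρ (1 / 2)) * (A * X - X * A)

/-- `𝓚_R = ∑_a 𝓚_a` over all single-site Pauli strings `a` on the sites of `R`. (The identity
string, common to all sites, contributes `𝓚_I = 0`, so it does not matter how often it occurs.) -/
noncomputable def auxGenOn {n q : ℕ} (ρ : Op n q) (R : Finset (Fin n)) (X : Op n q) : Op n q :=
  ∑ i ∈ R, ∑ P : Fin q → Fin 4, auxGen ρ (sitePauli i P) X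

/-- The conditional spectral gap `λ_R = inf_X ⟨X, -𝓚_R[X]⟩_ρ / Var_R(X)`, the infimum being over
the operators for which the quotient makes sense; it is `⊤` if there are none (as for `R = ∅`).
The numerator is real because `𝓚_R` is symmetric for the KMS inner product. -/
noncomputable def condSpectralGap {n q : ℕ} {ρ : Op n q} (hρ : ρ.PosDef)
    (R : Finset (Fin n)) : EReal :=
  ⨅ (X : Op n q) (_ : condVar hρ R X ≠ 0),
    (((kmsInner ρ X (-auxGenOn ρ R X)).re / condVar hρ R X : ℝ) : EReal)

end SpinChain

namespace SpinChain

/-! ### Locality -/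

/-! Cyclicity of the trace turns the Dirichlet form `⟨X, -𝓚_R X⟩_ρ` into `∑ ‖[P_i, X]‖_ρ²`, over the
Pauli strings `P` at the sites `i ∈ R` (`kmsInner_neg_auxGenOn`), and `Var_R(X)` is at most the
squared KMS distance from `X` to any operator supported off `R` (`condVar_le`). It thus suffices to
produce one such operator whose distance to `X` is controlled by the commutators.

It is obtained by twirling over Paulis. The average `E_i X = 4^{-q} ∑_P P X P` is the normalized
partial trace over `i`, and `X - E_i X` is the average of `[X, P] P`. Twirling is in general no
contraction for the KMS norm, but left multiplication by `P` costs only the factor `‖ρ^{1/4} P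
ρ^{-1/4}‖`, and right multiplication the same with opposite exponents. In one dimension Araki's
bound `norm_exp_conj_le` makes this factor at most `K = arakiConst β`, uniformly in `n` and `q`.
Hence `‖E_i X‖_ρ ≤ K² ‖X‖_ρ` and `‖X - E_i X‖_ρ ≤ K d_i`, where `d_i` is the mean of `‖[P_i, X]‖_ρ`
over `P`.

Removing the sites of `R` one at a time gives distance at most `K^{2|R|} ∑ d_i`
(`exists_supportedOn_near`). Cauchy–Schwarz and `|R| ≤ 2^{|R|}` then yield `Var_R(X) ≤ (2K⁴)^{|R|}
⟨X, -𝓚_R X⟩_ρ`, so `c = 2K⁴` works, even without the factor `2^q`. -/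

theorem localOp_apply {n q : ℕ} (S : Finset (Fin n)) (Y : LocOp n q S) (s t : Config n q) :
    localOp S Y s t
      = if ∀ j, j ∉ S → s j = t j then Y (fun j => s j) (fun j => t j) else 0 := rfl

theorem localOp_mul_localOp_apply {n q : ℕ} {S T : Finset (Fin n)} (hST : Disjoint S T)
    (Y : LocOp n q S) (Z : LocOp n q T) (s t : Config n q) :
    (localOp S Y * localOp T Z) s t
      = if ∀ j, j ∉ S → j ∉ T → s j = t j then
          Y (fun j => s j) (fun j => t j) * Z (fun j => s j) (fun j => t j) else 0 := by
  classical
  have hT : ∀ j ∈ T, j ∉ S := fun j hj hS => Finset.disjoint_left.mp hST hS hj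
  -- The only intermediate configuration that contributes agrees with `t` on `S` and with `s` off
  -- `S`.
  rw [Matrix.mul_apply, Finset.sum_eq_single (fun j => if j ∈ S then t j else s j)]
  · simp only [localOp_apply]
    rw [if_pos (fun j hj => by simp [hj])]
    have h1 : (fun j : S => (if (j : Fin n) ∈ S then t j else s j)) = fun j : S => t j := by
      funext j; simp
    have h2 : (fun j : T => (if (j : Fin n) ∈ S then t j else s j)) = fun j : T => s j := by
      funext j; simp [hT j j.2]
    rw [h1, h2, mul_ite, mul_zero]
    refine if_congr ⟨fun h j hS hjT => by simpa [hS] using h j hjT, fun h j hjT => ?_⟩ rfl rfl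
    by_cases hS : j ∈ S
    · simp [hS]
    · simpa [hS] using h j hS hjT
  · intro u _ hu
    simp only [localOp_apply]
    by_contra hne
    have h1 : ∀ j, j ∉ S → s j = u j := by
      by_contra h; exact hne (by rw [if_neg h, zero_mul])
    have h2 : ∀ j, j ∉ T → u j = t j := by
      by_contra h; exact hne (by rw [if_neg h, mul_zero])
    refine hu (funext fun j => ?_)
    by_cases hS : j ∈ S
    · simp [hS, h2 j (Finset.disjoint_left.mp hST hS)]
    · simp [hS, h1 j hS]
  · simp

/-- Operators with disjoint supports commute. -/
theorem commute_of_disjoint {n q : ℕ} {S T : Finset (Fin n)} (hST : Disjoint S T)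
    {M N : Op n q} (hM : M ∈ supportedOn S) (hN : N ∈ supportedOn T) : Commute M N := by
  obtain ⟨Y, rfl⟩ := hM
  obtain ⟨Z, rfl⟩ := hN
  ext s t
  rw [localOp_mul_localOp_apply hST, localOp_mul_localOp_apply hST.symm]
  exact if_congr ⟨fun h j a b => h j b a, fun h j a b => h j b a⟩ (mul_comm _ _) rfl

theorem siteOp_mem_supportedOn {n q : ℕ} (i : Fin n)
    (N : Matrix (Fin q → Fin 2) (Fin q → Fin 2) ℂ) : siteOp i N ∈ supportedOn {i} :=
  ⟨_, rfl⟩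

theorem siteOp_apply {n q : ℕ} (i : Fin n)
    (N : Matrix (Fin q → Fin 2) (Fin q → Fin 2) ℂ) (s t : Config n q) :
    siteOp i N s t = if ∀ j, j ≠ i → s j = t j then N (s i) (t i) else 0 := by
  simp [siteOp, localOp_apply]

theorem siteOp_mul_apply {n q : ℕ} (i : Fin n)
    (N : Matrix (Fin q → Fin 2) (Fin q → Fin 2) ℂ) (M : Op n q) (s t : Config n q) :
    (siteOp i N * M) s t = ∑ a, N (s i) a * M (Function.update s i a) t := by
  classical
  rw [Matrix.mul_apply]
  symm
  refine Finset.sum_of_injOn (fun a => Function.update s i a) ?_ (by simp) ?_ ?_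
  · intro a _ b _ h
    simpa using congrFun h i
  · intro u _ hu
    rw [siteOp_apply, if_neg, zero_mul]
    intro h
    refine hu ⟨u i, by simp, ?_⟩
    funext j
    by_cases hj : j = i
    · subst hj; simp
    · simp [hj, h j hj]
  · intro a _
    rw [siteOp_apply, if_pos (fun j hj => by simp [hj])]
    simp

theorem mul_siteOp_apply {n q : ℕ} (i : Fin n)
    (N : Matrix (Fin q → Fin 2) (Fin q → Fin 2) ℂ) (M : Op n q) (s t : Config n q) :
    (M * siteOp i N) s t = ∑ a, M s (Function.update t i a) * N a (t i) := by
  classical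
  rw [Matrix.mul_apply]
  symm
  refine Finset.sum_of_injOn (fun a => Function.update t i a) ?_ (by simp) ?_ ?_
  · intro a _ b _ h
    simpa using congrFun h i
  · intro u _ hu
    rw [siteOp_apply, if_neg, mul_zero]
    intro h
    refine hu ⟨u i, by simp, ?_⟩
    funext j
    by_cases hj : j = i
    · subst hj; simp
    · simp [hj, h j hj]
  · intro a _
    rw [siteOp_apply, if_pos (fun j hj => by simp [hj])]
    simp

/-- `M` acts as the identity on the site `i`. -/
def TrivialAt {n q : ℕ} (i : Fin n) (M : Op n q) : Prop :=
  (∀ s t, s i ≠ t i → M s t = 0) ∧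
    ∀ s t a, s i = t i → M (Function.update s i a) (Function.update t i a) = M s t

theorem TrivialAt.commute_siteOp {n q : ℕ} {i : Fin n} {M : Op n q} (hM : TrivialAt i M)
    (N : Matrix (Fin q → Fin 2) (Fin q → Fin 2) ℂ) : Commute (siteOp i N) M := by
  ext s t
  -- Since `M` is diagonal at `i`, only `a = t i` survives on the left and only `a = s i` on the
  -- right.
  rw [siteOp_mul_apply, mul_siteOp_apply, Finset.sum_eq_single (t i), Finset.sum_eq_single (s i)]
  · have h := hM.2 (Function.update s i (t i)) t (s i) (by simp)
    rw [Function.update_idem, Function.update_eq_self] at h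
    rw [h, mul_comm]
  · intro a _ ha
    rw [hM.1 _ _ (by simpa using ha.symm), zero_mul]
  · simp
  · intro a _ ha
    rw [hM.1 _ _ (by simpa using ha), mul_zero]
  · simp

theorem trivialAt_of_commute {n q : ℕ} {i : Fin n} {M : Op n q}
    (hM : ∀ N, Commute (siteOp i N) M) : TrivialAt i M := by
  classical
  -- Commutation is tested on the matrix units of the site.
  have key : ∀ (a b : Fin q → Fin 2) (s t : Config n q),
      (if s i = a then M (Function.update s i b) t else 0)
        = if t i = b then M s (Function.update t i a) else 0 := fun a b s t => by
    have h := congrFun (congrFun (hM (Matrix.single a b 1)) s) t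
    rw [siteOp_mul_apply, mul_siteOp_apply] at h
    simpa [Matrix.single_apply, ite_and, eq_comm] using h
  refine ⟨fun s t hst => ?_, fun s t a hst => ?_⟩
  · have h := key (s i) (s i) s t
    rwa [if_pos rfl, if_neg hst.symm, Function.update_eq_self] at h
  · have h := key a (s i) (Function.update s i a) t
    rw [if_pos (by simp), if_pos hst.symm, Function.update_idem, Function.update_eq_self] at h
    exact h.symm

theorem apply_eq_of_trivialAt {n q : ℕ} {M : Op n q} (F : Finset (Fin n))
    (hM : ∀ j ∈ F, TrivialAt j M) (s t s' t' : Config n q) (hst : ∀ j ∈ F, s j = t j)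
    (hst' : ∀ j ∈ F, s' j = t' j) (hs : ∀ j, j ∉ F → s j = s' j) (ht : ∀ j, j ∉ F → t j = t' j) :
    M s t = M s' t' := by
  classical
  induction F using Finset.induction_on generalizing s t with
  | empty =>
    rw [show s = s' from funext fun j => hs j (by simp),
      show t = t' from funext fun j => ht j (by simp)]
  | insert i F hi ih =>
    rw [← (hM i (by simp)).2 s t (s' i) (hst i (by simp))]
    refine ih (fun j hj => hM j (by simp [hj])) _ _ (fun j hj => ?_)
      (fun j hj => hst' j (by simp [hj])) (fun j hj => ?_) (fun j hj => ?_)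
    · have : j ≠ i := fun h => hi (h ▸ hj)
      simpa [this] using hst j (by simp [hj])
    · by_cases h : j = i
      · subst h; simp
      · simpa [h] using hs j (by simp [h, hj])
    · by_cases h : j = i
      · subst h; simpa using hst' j (by simp)
      · simpa [h] using ht j (by simp [h, hj])

theorem mem_supportedOn_of_trivialAt {n q : ℕ} {S : Finset (Fin n)} {M : Op n q}
    (hM : ∀ j, j ∉ S → TrivialAt j M) : M ∈ supportedOn S := by
  classical
  -- Entries do not depend on the common values outside `S`, so filling in zeros there loses
  -- nothing.
  refine ⟨Matrix.of fun u v => M (fun j => if h : j ∈ S then u ⟨j, h⟩ else 0)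
    (fun j => if h : j ∈ S then v ⟨j, h⟩ else 0), ?_⟩
  ext s t
  rw [localOp_apply]
  split_ifs with h
  · rw [Matrix.of_apply]
    refine apply_eq_of_trivialAt Sᶜ (fun j hj => hM j (by simpa using hj)) _ _ _ _ ?_ ?_ ?_ ?_
    · intro j hj
      simp [Finset.mem_compl.mp hj]
    · intro j hj
      exact h j (by simpa using hj)
    · intro j hj
      have : j ∈ S := by simpa using hj
      simp [this]
    · intro j hj
      have : j ∈ S := by simpa using hj
      simp [this]
  · push Not at h
    obtain ⟨j, hj, hne⟩ := h
    exact ((hM j hj).1 s t hne).symm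

/-- A commutant description of locality: closure under inclusions, products and twirls becomes a
statement about commuting operators. -/
theorem mem_supportedOn_iff_commute {n q : ℕ} {S : Finset (Fin n)} {M : Op n q} :
    M ∈ supportedOn S ↔ ∀ j, j ∉ S → ∀ N, Commute (siteOp j N) M :=
  ⟨fun hM j hj N => commute_of_disjoint (by simpa using hj) (siteOp_mem_supportedOn j N) hM,
    fun h => mem_supportedOn_of_trivialAt fun j hj => trivialAt_of_commute (h j hj)⟩

theorem supportedOn_mono {n q : ℕ} {S T : Finset (Fin n)} (h : S ⊆ T) :
    supportedOn (q := q) S ≤ supportedOn T := fun _ hM =>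
  mem_supportedOn_iff_commute.mpr fun j hj =>
    mem_supportedOn_iff_commute.mp hM j fun hS => hj (h hS)

theorem mul_mem_supportedOn {n q : ℕ} {S : Finset (Fin n)} {M N : Op n q}
    (hM : M ∈ supportedOn S) (hN : N ∈ supportedOn S) : M * N ∈ supportedOn S :=
  mem_supportedOn_iff_commute.mpr fun j hj K =>
    (mem_supportedOn_iff_commute.mp hM j hj K).mul_right
      (mem_supportedOn_iff_commute.mp hN j hj K)

/-! ### Pauli strings -/

theorem pauli_isHermitian (p : Fin 4) (a b : Fin 2) : star (pauli p b a) = pauli p a b := by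
  fin_cases p <;> fin_cases a <;> fin_cases b <;> simp [pauli]

theorem pauli_sq (p : Fin 4) (a b : Fin 2) :
    ∑ c, pauli p a c * pauli p c b = if a = b then 1 else 0 := by
  fin_cases p <;> fin_cases a <;> fin_cases b <;> simp [pauli]

/-- The sum `∑ p ⊗ p` is twice the swap; this is what makes the Pauli average a partial trace. -/
theorem pauli_completeness (a b c d : Fin 2) :
    ∑ p, pauli p a b * pauli p c d = if a = d ∧ b = c then 2 else 0 := by
  fin_cases a <;> fin_cases b <;> fin_cases c <;> fin_cases d <;>
    simp [pauli, Fin.sum_univ_four] <;> norm_num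

theorem pauliString_isHermitian {q : ℕ} (P : Fin q → Fin 4) :
    (pauliString P).conjTranspose = pauliString P := by
  ext s t
  simp only [pauliString, Matrix.conjTranspose_apply, Matrix.of_apply, star_prod,
    pauli_isHermitian]

theorem pauliString_sq {q : ℕ} (P : Fin q → Fin 4) : pauliString P * pauliString P = 1 := by
  ext s t
  simp only [Matrix.mul_apply, pauliString, Matrix.of_apply, ← Finset.prod_mul_distrib]
  rw [← Fintype.prod_sum (fun k c => pauli (P k) (s k) c * pauli (P k) c (t k))]
  simp only [pauli_sq, Matrix.one_apply, funext_iff]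
  rw [Finset.prod_ite_zero]
  simp

theorem pauliString_completeness {q : ℕ} (a b c d : Fin q → Fin 2) :
    ∑ P : Fin q → Fin 4, pauliString P a b * pauliString P c d
      = if a = d ∧ b = c then 2 ^ q else 0 := by
  simp only [pauliString, Matrix.of_apply, ← Finset.prod_mul_distrib]
  rw [← Fintype.prod_sum (fun k p => pauli p (a k) (b k) * pauli p (c k) (d k))]
  simp only [pauli_completeness, funext_iff, ← forall_and]
  rw [Finset.prod_ite_zero]
  simp

theorem sitePauli_isHermitian {n q : ℕ} (i : Fin n) (P : Fin q → Fin 4) :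
    (sitePauli i P).conjTranspose = sitePauli i P := by
  ext s t
  rw [Matrix.conjTranspose_apply, sitePauli, siteOp_apply, siteOp_apply]
  have h : star (pauliString P (t i) (s i)) = pauliString P (s i) (t i) := by
    rw [← Matrix.conjTranspose_apply, pauliString_isHermitian]
  rw [apply_ite star, star_zero, h]
  exact if_congr ⟨fun h j hj => (h j hj).symm, fun h j hj => (h j hj).symm⟩ rfl rfl

theorem sitePauli_mul_self {n q : ℕ} (i : Fin n) (P : Fin q → Fin 4) :
    sitePauli i P * sitePauli i P = 1 := by
  ext s t
  rw [sitePauli, siteOp_mul_apply]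
  simp only [siteOp_apply, Function.update_self]
  have h : ∀ a, (∀ j, j ≠ i → Function.update s i a j = t j) ↔ ∀ j, j ≠ i → s j = t j :=
    fun a => forall₂_congr fun j hj => by simp [hj]
  simp only [h, mul_ite, mul_zero]
  have h2 := congrFun (congrFun (pauliString_sq P) (s i)) (t i)
  rw [Matrix.mul_apply] at h2
  split_ifs with hst
  · rw [h2, Matrix.one_apply, Matrix.one_apply]
    refine if_congr ⟨fun h => funext fun j => ?_, fun h => by rw [h]⟩ rfl rfl
    by_cases hj : j = i
    · rw [hj, h]
    · exact hst j hj
  · rw [Finset.sum_const_zero, Matrix.one_apply, if_neg fun h => hst fun j _ => by rw [h]]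

/-- The normalized partial trace over the site `i`, as an average over Pauli strings. -/
noncomputable def siteTwirl {n q : ℕ} (i : Fin n) (X : Op n q) : Op n q :=
  ((4 : ℝ) ^ q)⁻¹ • ∑ P : Fin q → Fin 4, sitePauli i P * X * sitePauli i P

theorem siteTwirl_sum_apply {n q : ℕ} (i : Fin n) (X : Op n q) (s t : Config n q) :
    (∑ P : Fin q → Fin 4, sitePauli i P * X * sitePauli i P) s t
      = if s i = t i then
          2 ^ q * ∑ a, X (Function.update s i a) (Function.update t i a) else 0 := by
  classical
  rw [Matrix.sum_apply]
  have h : ∀ P : Fin q → Fin 4, (sitePauli i P * X * sitePauli i P) s t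
      = ∑ b, ∑ a, pauliString P (s i) a * pauliString P b (t i)
          * X (Function.update s i a) (Function.update t i b) := fun P => by
    rw [sitePauli, mul_siteOp_apply]
    refine Finset.sum_congr rfl fun b _ => ?_
    rw [siteOp_mul_apply, Finset.sum_mul]
    exact Finset.sum_congr rfl fun a _ => by ring
  simp only [h]
  rw [Finset.sum_comm]
  have h2 : ∀ b, ∑ P : Fin q → Fin 4, ∑ a, pauliString P (s i) a * pauliString P b (t i)
        * X (Function.update s i a) (Function.update t i b)
      = if s i = t i then 2 ^ q * X (Function.update s i b) (Function.update t i b) else 0 := by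
    intro b
    rw [Finset.sum_comm]
    simp only [← Finset.sum_mul, pauliString_completeness, ite_and]
    by_cases hst : s i = t i
    · simp [hst]
    · simp [hst]
  simp only [h2]
  split_ifs
  · rw [Finset.mul_sum]
  · simp

theorem siteTwirl_trivialAt {n q : ℕ} (i : Fin n) (X : Op n q) :
    TrivialAt i (siteTwirl i X) := by
  refine ⟨fun s t hst => ?_, fun s t a hst => ?_⟩
  · rw [siteTwirl, Matrix.smul_apply, siteTwirl_sum_apply, if_neg hst, smul_zero]
  · simp only [siteTwirl, Matrix.smul_apply, siteTwirl_sum_apply, Function.update_self,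
      Function.update_idem, if_pos hst, if_true]

theorem siteTwirl_mem_supportedOn {n q : ℕ} {i : Fin n} {S : Finset (Fin n)} {X : Op n q}
    (hX : X ∈ supportedOn S) : siteTwirl i X ∈ supportedOn (S.erase i) := by
  refine mem_supportedOn_iff_commute.mpr fun j hj N => ?_
  by_cases hji : j = i
  · subst hji
    exact (siteTwirl_trivialAt j X).commute_siteOp N
  · have hS : j ∉ S := fun h => hj (Finset.mem_erase.mpr ⟨hji, h⟩)
    have hP : ∀ P : Fin q → Fin 4, Commute (siteOp j N) (sitePauli i P) := fun P =>
      commute_of_disjoint (by simpa using hji) (siteOp_mem_supportedOn j N)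
        (siteOp_mem_supportedOn i _)
    exact (Commute.sum_right _ _ _ fun P _ => ((hP P).mul_right
      (mem_supportedOn_iff_commute.mp hX j hS N)).mul_right (hP P)).smul_right _

/-- As `P² = 1`, `X - P X P = [X, P] P`; it remains to average over the `4^q` strings. -/
theorem sub_siteTwirl {n q : ℕ} (i : Fin n) (X : Op n q) :
    X - siteTwirl i X = ((4 : ℝ) ^ q)⁻¹ • ∑ P : Fin q → Fin 4,
      (X * sitePauli i P - sitePauli i P * X) * sitePauli i P := by
  have h : ∀ P : Fin q → Fin 4, (X * sitePauli i P - sitePauli i P * X) * sitePauli i P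
      = X - sitePauli i P * X * sitePauli i P := fun P => by
    rw [sub_mul, mul_assoc X, sitePauli_mul_self, mul_one]
  simp only [h, Finset.sum_sub_distrib, smul_sub, siteTwirl]
  congr 1
  rw [Finset.sum_const, Finset.card_univ, Fintype.card_fun, Fintype.card_fin, Fintype.card_fin,
    ← Nat.cast_smul_eq_nsmul ℝ, smul_smul]
  push_cast
  rw [inv_mul_cancel₀ (by positivity), one_smul]

/-! ### Imaginary-time evolution in one dimension -/

/-- The commutator `X ↦ H X - X H` as a bounded operator. -/
noncomputable def commutatorCLM {𝔸 : Type*} [NormedRing 𝔸] [NormedAlgebra ℝ 𝔸] (H : 𝔸) :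
    𝔸 →L[ℝ] 𝔸 :=
  ContinuousLinearMap.mul ℝ 𝔸 H - (ContinuousLinearMap.mul ℝ 𝔸).flip H

theorem commutatorCLM_apply {𝔸 : Type*} [NormedRing 𝔸] [NormedAlgebra ℝ 𝔸] (H A : 𝔸) :
    commutatorCLM H A = H * A - A * H := rfl

theorem hasSum_exp_apply {E : Type*} [NormedAddCommGroup E] [NormedSpace ℝ E] [CompleteSpace E]
    (T : E →L[ℝ] E) (X : E) :
    HasSum (fun k : ℕ => (k.factorial⁻¹ : ℝ) • (T ^ k) X) (NormedSpace.exp T X) := by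
  have h := (NormedSpace.exp_series_hasSum_exp' (𝕂 := ℝ) T).mapL (ContinuousLinearMap.apply ℝ E X)
  simpa only [ContinuousLinearMap.apply_apply, smul_apply] using h

theorem exp_mulLeft_apply {𝔸 : Type*} [NormedRing 𝔸] [NormedAlgebra ℝ 𝔸] [CompleteSpace 𝔸]
    (H X : 𝔸) :
    NormedSpace.exp (ContinuousLinearMap.mul ℝ 𝔸 H) X = NormedSpace.exp H * X := by
  have hpow : ∀ (k : ℕ) X, (ContinuousLinearMap.mul ℝ 𝔸 H ^ k) X = H ^ k * X := fun k => by
    induction k with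
    | zero => intro X; rw [pow_zero, pow_zero, one_mul]; rfl
    | succ k ih =>
      intro X
      rw [pow_succ, pow_succ, mul_assoc, ContinuousLinearMap.mul_def, ContinuousLinearMap.comp_apply, ih,
        ContinuousLinearMap.mul_apply']
  refine (hasSum_exp_apply _ X).unique ?_
  simp only [hpow, ← smul_mul_assoc]
  exact (NormedSpace.exp_series_hasSum_exp' (𝕂 := ℝ) H).mul_right X

theorem exp_mulRight_apply {𝔸 : Type*} [NormedRing 𝔸] [NormedAlgebra ℝ 𝔸] [CompleteSpace 𝔸]
    (H X : 𝔸) :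
    NormedSpace.exp ((ContinuousLinearMap.mul ℝ 𝔸).flip H) X = X * NormedSpace.exp H := by
  have hpow : ∀ (k : ℕ) X, ((ContinuousLinearMap.mul ℝ 𝔸).flip H ^ k) X = X * H ^ k := fun k => by
    induction k with
    | zero => intro X; rw [pow_zero, pow_zero, mul_one]; rfl
    | succ k ih =>
      intro X
      rw [pow_succ, pow_succ', ← mul_assoc, ContinuousLinearMap.mul_def, ContinuousLinearMap.comp_apply, ih,
        ContinuousLinearMap.flip_apply, ContinuousLinearMap.mul_apply']
  refine (hasSum_exp_apply _ X).unique ?_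
  simp only [hpow, ← mul_smul_comm]
  exact (NormedSpace.exp_series_hasSum_exp' (𝕂 := ℝ) H).mul_left X

/-- The commutator is left multiplication by `H` plus right multiplication by `-H`; these commute,
so its exponential factorizes. -/
theorem hasSum_exp_conj {𝔸 : Type*} [NormedRing 𝔸] [NormedAlgebra ℝ 𝔸] [CompleteSpace 𝔸]
    (H A : 𝔸) :
    HasSum (fun k : ℕ => (k.factorial⁻¹ : ℝ) • (commutatorCLM H ^ k) A)
      (NormedSpace.exp H * A * NormedSpace.exp (-H)) := by
  have hcomm : Commute (ContinuousLinearMap.mul ℝ 𝔸 H)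
      ((ContinuousLinearMap.mul ℝ 𝔸).flip (-H)) :=
    ContinuousLinearMap.ext fun X => (mul_assoc H X (-H)).symm
  have hD : commutatorCLM H
      = ContinuousLinearMap.mul ℝ 𝔸 H + (ContinuousLinearMap.mul ℝ 𝔸).flip (-H) := by
    rw [commutatorCLM, map_neg, sub_eq_add_neg]
  let _ : NormedAlgebra ℚ (𝔸 →L[ℝ] 𝔸) := NormedAlgebra.restrictScalars ℚ ℝ _
  have h : NormedSpace.exp (commutatorCLM H) A
      = NormedSpace.exp H * A * NormedSpace.exp (-H) := by
    rw [hD, NormedSpace.exp_add_of_commute hcomm, ContinuousLinearMap.mul_def,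
      ContinuousLinearMap.comp_apply,
      exp_mulLeft_apply, exp_mulRight_apply, mul_assoc]
  rw [← h]
  exact hasSum_exp_apply _ A

/-- The number of ways in which an interval with `m` links can be hit `k` times by links which
lie inside it or extend it by one. -/
def growthCount : ℕ → ℕ → ℝ
  | 0, _ => 1
  | k + 1, m => m * growthCount k m + 2 * growthCount k (m + 1)

theorem growthCount_nonneg (k m : ℕ) : 0 ≤ growthCount k m := by
  induction k generalizing m with
  | zero => simp [growthCount]
  | succ k ih =>
    have h1 := ih m
    have h2 := ih (m + 1)
    rw [growthCount]
    positivity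

/-- The generating functions `G_m(t) = ∑ t^k growthCount k m / k!` formally solve `G_m' = m G_m + 2
G_{m+1}`, `G_m(0) = 1`, as do the functions `exp(mt + 2(e^t - 1))`. For partial sums the derivative
lowers `N`, so induction on `N` compares derivatives on `t ≥ 0`. -/
theorem sum_growthCount_le (N m : ℕ) {t : ℝ} (ht : 0 ≤ t) :
    ∑ k ∈ Finset.range N, (k.factorial⁻¹ : ℝ) * (t ^ k * growthCount k m)
      ≤ Real.exp (m * t + 2 * (Real.exp t - 1)) := by
  induction N generalizing m t with
  | zero => simp [Real.exp_nonneg]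
  | succ N ih =>
    let f : ℕ → ℕ → ℝ → ℝ := fun N m t =>
      ∑ k ∈ Finset.range N, (k.factorial⁻¹ : ℝ) * (t ^ k * growthCount k m)
    let u : ℕ → ℝ → ℝ := fun m t => Real.exp (m * t + 2 * (Real.exp t - 1))
    have hf : ∀ t, HasDerivAt (f (N + 1) m) (m * f N m t + 2 * f N (m + 1) t) t := fun t => by
      have h : ∀ k ∈ Finset.range N, HasDerivAt
          (fun t : ℝ => ((k + 1).factorial⁻¹ : ℝ) * (t ^ (k + 1) * growthCount (k + 1) m))
          (m * ((k.factorial⁻¹ : ℝ) * (t ^ k * growthCount k m))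
            + 2 * ((k.factorial⁻¹ : ℝ) * (t ^ k * growthCount k (m + 1)))) t := fun k _ => by
        convert! ((hasDerivAt_pow (k + 1) t).mul_const (growthCount (k + 1) m)).const_mul
          ((k + 1).factorial⁻¹ : ℝ) using 1
        rw [growthCount, Nat.factorial_succ]
        push_cast
        have : (k.factorial : ℝ) ≠ 0 := by positivity
        field_simp
      -- The constant is the `k = 0` term; the index shift accounts for the rest.
      have h2 := (HasDerivAt.fun_sum h).add_const
        (((0 : ℕ).factorial⁻¹ : ℝ) * (1 * growthCount 0 m))
      simp only [f, Finset.mul_sum, ← Finset.sum_add_distrib]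
      refine h2.congr_of_eventuallyEq (Filter.Eventually.of_forall fun x => ?_)
      simp only [Finset.sum_range_succ', pow_zero]
    have hu : ∀ t, HasDerivAt (u m) (m * u m t + 2 * u (m + 1) t) t := fun t => by
      have h := (((hasDerivAt_id t).const_mul (m : ℝ)).add
        (((Real.hasDerivAt_exp t).sub_const 1).const_mul 2)).exp
      convert! h using 1
      have h3 : u (m + 1) t = u m t * Real.exp t := by
        simp only [u, ← Real.exp_add]
        push_cast
        congr 1
        ring
      rw [h3]
      simp only [u, Pi.add_apply, id]
      ring
    have hmono : MonotoneOn (fun t => u m t - f (N + 1) m t) (Set.Ici 0) := by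
      refine monotoneOn_of_hasDerivWithinAt_nonneg (convex_Ici 0)
        (fun t _ => ((hu t).sub (hf t)).continuousAt.continuousWithinAt)
        (fun t _ => ((hu t).sub (hf t)).hasDerivWithinAt) fun t ht => ?_
      have ht : 0 ≤ t := (by simpa using ht : 0 < t).le
      have h1 : f N m t ≤ u m t := ih m ht
      have h2 : f N (m + 1) t ≤ u (m + 1) t := ih (m + 1) ht
      have h3 : (m : ℝ) * f N m t ≤ m * u m t := by gcongr
      linarith
    have h := hmono Set.self_mem_Ici ht ht
    have hf0 : f (N + 1) m 0 = 1 := by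
      simp [f, Finset.sum_range_succ', growthCount]
    have hu0 : u m 0 = 1 := by simp [u]
    simp only [hf0, hu0, sub_self] at h
    exact sub_nonneg.mp h

/-- The sites `a, …, a + m`. -/
def interval (n a m : ℕ) : Finset (Fin n) :=
  Finset.univ.filter fun j => a ≤ (j : ℕ) ∧ (j : ℕ) ≤ a + m

theorem mem_interval {n a m : ℕ} {j : Fin n} :
    j ∈ interval n a m ↔ a ≤ (j : ℕ) ∧ (j : ℕ) ≤ a + m := by
  simp [interval]

theorem commutator_mem_supportedOn {n q : ℕ} {S T U : Finset (Fin n)} (hS : S ⊆ U) (hT : T ⊆ U)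
    {M N : Op n q} (hM : M ∈ supportedOn S) (hN : N ∈ supportedOn T) :
    M * N - N * M ∈ supportedOn U :=
  Submodule.sub_mem _
    (mul_mem_supportedOn (supportedOn_mono hS hM) (supportedOn_mono hT hN))
    (mul_mem_supportedOn (supportedOn_mono hT hN) (supportedOn_mono hS hM))

theorem sum_ite_le_of_val {k : ℕ} (p : Fin k → Prop) [DecidablePred p] (F : Finset ℕ)
    (hp : ∀ b, p b → (b : ℕ) ∈ F) {x : ℝ} (hx : 0 ≤ x) :
    ∑ b, (if p b then x else 0) ≤ F.card * x := by
  rw [← Finset.sum_filter, Finset.sum_const, nsmul_eq_mul]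
  gcongr
  exact Finset.card_le_card_of_injOn (fun b => (b : ℕ)) (fun b hb => hp b (by simpa using hb))
    (fun a _ b _ h => Fin.ext h)

open scoped Matrix.Norms.L2Operator in
-- A commutator with one link costs `2r`. Links away from the interval drop out, the `m` inner links
-- preserve it, and at most two boundary links lengthen it by one: the recursion of `growthCount`.
theorem norm_commutator_pow_le {n q : ℕ} {h : Fin (n - 1) → Op n q} {r : ℝ} (hr : 0 ≤ r)
    (hsupp : ∀ b : Fin (n - 1),
      h b ∈ supportedOn {(⟨b, by omega⟩ : Fin n), (⟨b + 1, by omega⟩ : Fin n)})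
    (hnorm : ∀ b, ‖h b‖ ≤ r) (k a m : ℕ) {A : Op n q} (hA : A ∈ supportedOn (interval n a m)) :
    ‖(commutatorCLM (∑ b, h b) ^ k) A‖ ≤ (2 * r) ^ k * growthCount k m * ‖A‖ := by
  induction k generalizing a m A with
  | zero => simp [growthCount]
  | succ k ih =>
    have hcomm : ∀ b, ‖h b * A - A * h b‖ ≤ 2 * r * ‖A‖ := fun b => by
      have h1 := norm_mul_le (h b) A
      have h2 := norm_mul_le A (h b)
      have h3 : ‖h b‖ * ‖A‖ ≤ r * ‖A‖ := by gcongr; exact hnorm b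
      calc _ ≤ ‖h b * A‖ + ‖A * h b‖ := norm_sub_le _ _
        _ ≤ 2 * r * ‖A‖ := by linarith
    have hstep : ∀ (b : Fin (n - 1)) (a' m' : ℕ), interval n a m ⊆ interval n a' m' →
        a' ≤ (b : ℕ) → (b : ℕ) + 1 ≤ a' + m' →
        ‖(commutatorCLM (∑ b, h b) ^ k) (h b * A - A * h b)‖
          ≤ (2 * r) ^ (k + 1) * ‖A‖ * growthCount k m' := fun b a' m' hI h1 h2 => by
      have hmem : h b * A - A * h b ∈ supportedOn (interval n a' m') := by
        refine commutator_mem_supportedOn (fun j hj => ?_) hI (hsupp b) hA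
        rw [mem_interval]
        rcases Finset.mem_insert.mp hj with rfl | hj
        · simp only; omega
        · rw [Finset.mem_singleton.mp hj]; simp only; omega
      have hg := growthCount_nonneg k m'
      calc _ ≤ (2 * r) ^ k * growthCount k m' * ‖h b * A - A * h b‖ := ih a' m' hmem
        _ ≤ (2 * r) ^ k * growthCount k m' * (2 * r * ‖A‖) := by gcongr; exact hcomm b
        _ = _ := by ring
    set x := (2 * r) ^ (k + 1) * ‖A‖ * growthCount k m with hx
    set y := (2 * r) ^ (k + 1) * ‖A‖ * growthCount k (m + 1) with hy
    have hx0 : 0 ≤ x := by have := growthCount_nonneg k m; positivity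
    have hy0 : 0 ≤ y := by have := growthCount_nonneg k (m + 1); positivity
    have hterm : ∀ b : Fin (n - 1), ‖(commutatorCLM (∑ b, h b) ^ k) (h b * A - A * h b)‖
        ≤ (if a ≤ (b : ℕ) ∧ (b : ℕ) < a + m then x else 0)
          + (if (b : ℕ) + 1 = a then y else 0) + (if (b : ℕ) = a + m then y else 0) := fun b => by
      by_cases h1 : a ≤ (b : ℕ) ∧ (b : ℕ) < a + m
      · rw [if_pos h1, if_neg (by omega), if_neg (by omega), add_zero, add_zero]
        exact hstep b a m subset_rfl h1.1 (by omega)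
      by_cases h2 : (b : ℕ) + 1 = a
      · rw [if_neg h1, if_pos h2, if_neg (by omega), add_zero, zero_add]
        refine hstep b (a - 1) (m + 1) (fun j hj => ?_) (by omega) (by omega)
        rw [mem_interval] at hj ⊢
        omega
      by_cases h3 : (b : ℕ) = a + m
      · rw [if_neg h1, if_neg h2, if_pos h3, add_zero, zero_add]
        refine hstep b a (m + 1) (fun j hj => ?_) (by omega) (by omega)
        rw [mem_interval] at hj ⊢
        omega
      · have hc : Commute (h b) A := by
          refine commute_of_disjoint (Finset.disjoint_left.mpr fun j hj hI => ?_) (hsupp b) hA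
          rw [mem_interval] at hI
          rcases Finset.mem_insert.mp hj with rfl | hj
          · simp only at hI; omega
          · rw [Finset.mem_singleton.mp hj] at hI; simp only at hI; omega
        rw [hc.eq, sub_self, map_zero, norm_zero]
        simp [h1, h2, h3]
    -- The innermost commutator is split off, so that the induction hypothesis applies to each `[h
    -- b, A]` on its own interval.
    have hexp : (commutatorCLM (∑ b, h b) ^ (k + 1)) A
        = ∑ b, (commutatorCLM (∑ b, h b) ^ k) (h b * A - A * h b) := by
      rw [pow_succ, ContinuousLinearMap.mul_def, ContinuousLinearMap.comp_apply,
        commutatorCLM_apply, ← map_sum,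
        Finset.sum_sub_distrib, Finset.sum_mul, Finset.mul_sum]
    calc ‖(commutatorCLM (∑ b, h b) ^ (k + 1)) A‖
        ≤ ∑ b : Fin (n - 1), ((if a ≤ (b : ℕ) ∧ (b : ℕ) < a + m then x else 0)
          + (if (b : ℕ) + 1 = a then y else 0) + (if (b : ℕ) = a + m then y else 0)) := by
          rw [hexp]
          exact norm_sum_le_of_le _ fun b _ => hterm b
      -- For `a = 0` there is no link on the left; the truncated `a - 1` then only weakens the
      -- bound.
      _ ≤ (Finset.Ico a (a + m)).card * x + ({a - 1} : Finset ℕ).card * y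
          + ({a + m} : Finset ℕ).card * y := by
          rw [Finset.sum_add_distrib, Finset.sum_add_distrib]
          refine add_le_add (add_le_add ?_ ?_) ?_ <;>
            refine sum_ite_le_of_val _ _ (fun b hb => ?_) (by assumption)
          · simpa using hb
          · simp only [Finset.mem_singleton]; omega
          · simpa using hb
      _ = (2 * r) ^ (k + 1) * growthCount (k + 1) m * ‖A‖ := by
          rw [growthCount, hx, hy]
          simp
          ring

open scoped Matrix.Norms.L2Operator in
/-- Araki's bound: in one dimension the imaginary-time evolution of a single-site operator is
bounded uniformly in the length of the chain. -/
theorem norm_exp_conj_le {n q : ℕ} {h : Fin (n - 1) → Op n q} {r : ℝ} (hr : 0 ≤ r)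
    (hsupp : ∀ b : Fin (n - 1),
      h b ∈ supportedOn {(⟨b, by omega⟩ : Fin n), (⟨b + 1, by omega⟩ : Fin n)})
    (hnorm : ∀ b, ‖h b‖ ≤ r) {i : Fin n} {A : Op n q} (hA : A ∈ supportedOn {i}) :
    ‖NormedSpace.exp (∑ b, h b) * A * NormedSpace.exp (-∑ b, h b)‖
      ≤ Real.exp (2 * (Real.exp (2 * r) - 1)) * ‖A‖ := by
  -- A single site is an interval with no links, hence `m = 0`.
  have hA' : A ∈ supportedOn (interval n i 0) := by
    refine supportedOn_mono (fun j hj => ?_) hA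
    rw [Finset.mem_singleton.mp hj, mem_interval]
    omega
  refine le_of_tendsto (hasSum_exp_conj (∑ b, h b) A).tendsto_sum_nat.norm
    (Filter.Eventually.of_forall fun N => ?_)
  have h1 := sum_growthCount_le N 0 (t := 2 * r) (by positivity)
  rw [Nat.cast_zero, zero_mul, zero_add] at h1
  refine le_trans ?_ (mul_le_mul_of_nonneg_right h1 (norm_nonneg A))
  rw [Finset.sum_mul]
  refine norm_sum_le_of_le _ fun k _ => ?_
  rw [norm_smul, Real.norm_of_nonneg (by positivity), mul_assoc]
  gcongr
  exact norm_commutator_pow_le hr hsupp hnorm k i 0 hA'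

/-! ### Powers of Gibbs states -/

theorem Hamiltonian1D.total_isHermitian {n q : ℕ} (H : Hamiltonian1D n q) :
    H.total.IsHermitian := by
  unfold Hamiltonian1D.total Matrix.IsHermitian
  rw [Matrix.conjTranspose_sum]
  exact Finset.sum_congr rfl fun b _ => H.isHermitian b

open scoped Matrix.Norms.L2Operator in
theorem exp_smul_eq_cfc {n q : ℕ} {M : Op n q} (hM : M.IsHermitian) (c : ℝ) :
    NormedSpace.exp (c • M) = cfc (fun x : ℝ => Real.exp (c * x)) M := by
  have hM' : IsSelfAdjoint M := hM
  have hc : IsSelfAdjoint (c • M) := (IsSelfAdjoint.all c).smul hM'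
  rw [← CFC.real_exp_eq_normedSpace_exp hc]
  exact (cfc_comp_smul c Real.exp M (by fun_prop) hM').symm

/-- Here `Z` is the reciprocal of the partition function. Its powers cancel in `ρ^s A ρ^{-s}`,
leaving imaginary-time evolution under `H`. -/
theorem exists_matPow_gibbs {n q : ℕ} (β : ℝ) (H : Hamiltonian1D n q) :
    ∃ Z : ℝ, 0 < Z ∧ ∀ s : ℝ, matPow (gibbs β H) s
      = Z ^ s • NormedSpace.exp ((-(β * s)) • H.total) := by
  have hβ : -(β : ℂ) • H.total = (-β) • H.total := by
    ext s t
    simp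
  have hpos : 0 < ((NormedSpace.exp (-(β : ℂ) • H.total)).trace)⁻¹ := by
    have h := (gibbs_posDef β H).trace_pos
    rw [gibbs, Matrix.trace_smul, smul_eq_mul] at h
    by_contra hn
    have h0 : (NormedSpace.exp (-(β : ℂ) • H.total)).trace ≠ 0 := fun h0 => by
      rw [h0, mul_zero] at h
      exact h.ne rfl
    have h1 : (NormedSpace.exp (-(β : ℂ) • H.total)).PosSemidef := by
      have hA : (-((β / 2 : ℝ) : ℂ) • H.total).IsHermitian := by
        unfold Matrix.IsHermitian
        rw [Matrix.conjTranspose_smul, H.total_isHermitian.eq]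
        simp
      have hE : NormedSpace.exp (-(β : ℂ) • H.total)
          = NormedSpace.exp (-((β / 2 : ℝ) : ℂ) • H.total)
            * (NormedSpace.exp (-((β / 2 : ℝ) : ℂ) • H.total)).conjTranspose := by
        rw [hA.exp.eq, ← Matrix.exp_add_of_commute _ _ (Commute.refl _), ← add_smul]
        congr 2
        push_cast
        ring
      rw [hE]
      exact Matrix.posSemidef_self_mul_conjTranspose _
    exact hn (inv_pos.mpr (h1.trace_nonneg.lt_of_ne h0.symm))
  obtain ⟨hre, him⟩ := Complex.lt_def.mp hpos
  set z := ((NormedSpace.exp (-(β : ℂ) • H.total)).trace)⁻¹ with hz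
  have hzr : z = (z.re : ℂ) := Complex.ext rfl (by simpa using him.symm)
  refine ⟨z.re, hre, fun s => ?_⟩
  -- Once the Gibbs state is a function of `H`, its powers follow by composition in the functional
  -- calculus.
  have hg : gibbs β H = cfc (fun x : ℝ => z.re * Real.exp (-β * x)) H.total := by
    rw [cfc_const_mul z.re _ H.total (by fun_prop), ← exp_smul_eq_cfc H.total_isHermitian,
      gibbs, ← hz, ← hβ, hzr]
    ext
    simp
  have hsa : IsSelfAdjoint H.total := H.total_isHermitian
  rw [matPow, hg, ← cfc_comp' (fun x : ℝ => x ^ s) _ H.total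
    (fun x hx => (Real.continuousAt_rpow_const x s (Or.inl ?_)).continuousWithinAt)
    (by fun_prop) hsa, exp_smul_eq_cfc H.total_isHermitian,
    ← cfc_const_mul (z.re ^ s) _ H.total (by fun_prop)]
  · refine cfc_congr fun x _ => ?_
    rw [Real.mul_rpow hre.le (Real.exp_nonneg _), ← Real.exp_mul]
    congr 2
    ring
  · obtain ⟨y, _, rfl⟩ := hx
    exact (mul_pos hre (Real.exp_pos _)).ne'

open scoped Matrix.Norms.L2Operator in
theorem norm_matPow_conj_le {n q : ℕ} (β : ℝ) (H : Hamiltonian1D n q) (s : ℝ) {i : Fin n}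
    {A : Op n q} (hA : A ∈ supportedOn {i}) :
    ‖matPow (gibbs β H) s * A * matPow (gibbs β H) (-s)‖
      ≤ Real.exp (2 * (Real.exp (2 * |β * s|) - 1)) * ‖A‖ := by
  obtain ⟨Z, hZ, hpow⟩ := exists_matPow_gibbs β H
  have h1 : (-(β * s)) • H.total = ∑ b, (-(β * s)) • H.link b := by
    rw [Hamiltonian1D.total, Finset.smul_sum]
  have h2 : (-(β * -s)) • H.total = -∑ b, (-(β * s)) • H.link b := by
    rw [← h1, ← neg_smul]
    congr 1
    ring
  rw [hpow, hpow, h1, h2, smul_mul_assoc, smul_mul_smul_comm, ← Real.rpow_add hZ, add_neg_cancel,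
    Real.rpow_zero, one_smul]
  refine norm_exp_conj_le (abs_nonneg _) (fun b => ?_) (fun b => ?_) hA
  · exact Submodule.smul_of_tower_mem _ _ (H.supported b)
  · rw [norm_smul, norm_neg, Real.norm_eq_abs]
    exact mul_le_of_le_one_right (abs_nonneg _) (H.norm_le b)

/-! ### The KMS norm -/

theorem kmsNorm_add_le {n q : ℕ} {ρ : Op n q} (hρ : ρ.PosDef) (X Y : Op n q) :
    kmsNorm ρ (X + Y) ≤ kmsNorm ρ X + kmsNorm ρ Y := by
  let _ : NormedAddCommGroup (Op n q) := (kmsCore hρ).toNormedAddCommGroup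
  exact norm_add_le X Y

theorem kmsNorm_sum_le {n q : ℕ} {ρ : Op n q} (hρ : ρ.PosDef) {ι : Type*} (F : Finset ι)
    (X : ι → Op n q) : kmsNorm ρ (∑ i ∈ F, X i) ≤ ∑ i ∈ F, kmsNorm ρ (X i) := by
  let _ : NormedAddCommGroup (Op n q) := (kmsCore hρ).toNormedAddCommGroup
  exact norm_sum_le F X

theorem kmsNorm_smul {n q : ℕ} (ρ : Op n q) {a : ℝ} (ha : 0 ≤ a) (X : Op n q) :
    kmsNorm ρ (a • X) = a * kmsNorm ρ X := by
  have h : kmsInner ρ (a • X) (a • X) = ((a ^ 2 : ℝ) : ℂ) * kmsInner ρ X X := by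
    simp [kmsInner, pow_two, mul_assoc]
  rw [kmsNorm, kmsNorm, h, Complex.re_ofReal_mul, Real.sqrt_mul (sq_nonneg a), Real.sqrt_sq ha]

theorem kmsInner_self_nonneg {n q : ℕ} {ρ : Op n q} (hρ : ρ.PosDef) (X : Op n q) :
    0 ≤ (kmsInner ρ X X).re := (kmsCore hρ).re_inner_nonneg X

theorem kmsNorm_sq {n q : ℕ} {ρ : Op n q} (hρ : ρ.PosDef) (X : Op n q) :
    kmsNorm ρ X ^ 2 = (kmsInner ρ X X).re := Real.sq_sqrt (kmsInner_self_nonneg hρ X)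

theorem kmsNorm_nonneg {n q : ℕ} (ρ X : Op n q) : 0 ≤ kmsNorm ρ X := Real.sqrt_nonneg _

/-- The conditional expectation is the best approximation by operators supported outside `R`. -/
theorem condVar_le {n q : ℕ} {ρ : Op n q} (hρ : ρ.PosDef) (R : Finset (Fin n)) (X : Op n q)
    {Y : Op n q} (hY : Y ∈ supportedOn Rᶜ) : condVar hρ R X ≤ kmsNorm ρ (X - Y) ^ 2 := by
  obtain ⟨hE, horth⟩ := kmsExpansion_spec Rᶜ (exists_kmsBasis hρ Rᶜ).choose_spec X
  change condExp hρ R X ∈ _ at hE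
  change ∀ Z ∈ _, kmsInner ρ (X - condExp hρ R X) Z = 0 at horth
  set E := condExp hρ R X with hEdef
  have h1 : kmsInner ρ (X - E) (E - Y) = 0 := horth _ (Submodule.sub_mem _ hE hY)
  have h2 : kmsInner ρ (E - Y) (X - E) = 0 := by
    have h := (kmsCore hρ).conj_inner_symm (E - Y) (X - E)
    change star (kmsInner ρ (X - E) (E - Y)) = kmsInner ρ (E - Y) (X - E) at h
    rw [← h, h1, star_zero]
  have h3 : kmsInner ρ (X - Y) (X - Y) = kmsInner ρ (X - E) (X - E)
      + kmsInner ρ (X - E) (E - Y) + kmsInner ρ (E - Y) (X - E)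
      + kmsInner ρ (E - Y) (E - Y) := by
    rw [← sub_add_sub_cancel X E Y]
    simp only [kmsInner, Matrix.conjTranspose_add, Matrix.add_mul, Matrix.mul_add,
      Matrix.trace_add]
    ring
  have h4 := kmsInner_self_nonneg hρ (E - Y)
  rw [condVar, ← hEdef, kmsNorm_sq hρ, kmsNorm_sq hρ, h3, h1, h2, add_zero, add_zero,
    Complex.add_re]
  linarith

/-- The Hilbert-Schmidt norm. -/
noncomputable def hsNorm {n q : ℕ} (M : Op n q) : ℝ :=
  Real.sqrt (M.conjTranspose * M).trace.re

theorem kmsNorm_eq_hsNorm {n q : ℕ} {ρ : Op n q} (hρ : ρ.PosDef) (X : Op n q) :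
    kmsNorm ρ X = hsNorm (matPow ρ (1 / 4) * X * matPow ρ (1 / 4)) := by
  rw [kmsNorm, kmsInner_self_eq hρ, hsNorm]

theorem hsNorm_conjTranspose {n q : ℕ} (M : Op n q) : hsNorm M.conjTranspose = hsNorm M := by
  rw [hsNorm, hsNorm, Matrix.conjTranspose_conjTranspose, Matrix.trace_mul_comm]

theorem trace_conjTranspose_mul_self_re {n q : ℕ} (M : Op n q) :
    (M.conjTranspose * M).trace.re
      = ∑ t, ‖(WithLp.toLp 2 (M.col t) : EuclideanSpace ℂ (Config n q))‖ ^ 2 := by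
  simp only [EuclideanSpace.norm_sq_eq, Matrix.trace, Matrix.diag_apply, Matrix.mul_apply,
    Matrix.conjTranspose_apply, Complex.re_sum, Matrix.col_apply]
  refine Finset.sum_congr rfl fun t _ => Finset.sum_congr rfl fun s _ => ?_
  rw [Complex.star_def, ← Complex.normSq_eq_conj_mul_self, Complex.ofReal_re,
    Complex.normSq_eq_norm_sq]

open scoped Matrix.Norms.L2Operator in
-- The squared Hilbert–Schmidt norm is the sum over columns, on each of which `B` acts with its
-- operator norm.
theorem hsNorm_mul_le {n q : ℕ} (B M : Op n q) : hsNorm (B * M) ≤ ‖B‖ * hsNorm M := by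
  rw [hsNorm, hsNorm, ← Real.sqrt_sq (norm_nonneg B), ← Real.sqrt_mul (sq_nonneg _)]
  refine Real.sqrt_le_sqrt ?_
  rw [trace_conjTranspose_mul_self_re, trace_conjTranspose_mul_self_re, Finset.mul_sum]
  refine Finset.sum_le_sum fun t _ => ?_
  rw [← mul_pow]
  refine pow_le_pow_left₀ (norm_nonneg _) ?_ 2
  exact Matrix.l2_opNorm_mulVec B (WithLp.toLp 2 (M.col t))

open scoped Matrix.Norms.L2Operator in
theorem hsNorm_mul_le_right {n q : ℕ} (M B : Op n q) : hsNorm (M * B) ≤ hsNorm M * ‖B‖ := by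
  rw [← hsNorm_conjTranspose, Matrix.conjTranspose_mul, ← hsNorm_conjTranspose M,
    ← Matrix.l2_opNorm_conjTranspose B, mul_comm]
  exact hsNorm_mul_le _ _

open scoped Matrix.Norms.L2Operator in
-- The KMS norm of `X` is the Hilbert–Schmidt norm of `ρ^{1/4} X ρ^{1/4}`; inserting `ρ^{-1/4}
-- ρ^{1/4}` between `A` and `X` isolates the conjugated `A`.
theorem kmsNorm_mul_le {n q : ℕ} {ρ : Op n q} (hρ : ρ.PosDef) (A X : Op n q) :
    kmsNorm ρ (A * X) ≤ ‖matPow ρ (1 / 4) * A * matPow ρ (-(1 / 4))‖ * kmsNorm ρ X := by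
  rw [kmsNorm_eq_hsNorm hρ, kmsNorm_eq_hsNorm hρ]
  refine le_trans (le_of_eq ?_) (hsNorm_mul_le _ _)
  have h : matPow ρ (-(1 / 4)) * matPow ρ (1 / 4) = 1 := by
    rw [matPow_add hρ, neg_add_cancel, matPow_zero hρ]
  congr 1
  calc _ = matPow ρ (1 / 4) * A * 1 * X * matPow ρ (1 / 4) := by simp only [mul_assoc, mul_one]
    _ = _ := by rw [← h]; simp only [mul_assoc]

open scoped Matrix.Norms.L2Operator in
theorem kmsNorm_mul_le_right {n q : ℕ} {ρ : Op n q} (hρ : ρ.PosDef) (X A : Op n q) :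
    kmsNorm ρ (X * A) ≤ kmsNorm ρ X * ‖matPow ρ (-(1 / 4)) * A * matPow ρ (1 / 4)‖ := by
  rw [kmsNorm_eq_hsNorm hρ, kmsNorm_eq_hsNorm hρ]
  refine le_trans (le_of_eq ?_) (hsNorm_mul_le_right _ _)
  have h : matPow ρ (1 / 4) * matPow ρ (-(1 / 4)) = 1 := by
    rw [matPow_add hρ, add_neg_cancel, matPow_zero hρ]
  congr 1
  calc _ = matPow ρ (1 / 4) * X * 1 * A * matPow ρ (1 / 4) := by simp only [mul_assoc, mul_one]
    _ = _ := by rw [← h]; simp only [mul_assoc]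

/-! ### The Dirichlet form -/

/-- The conjugations of `A†` in the generator cancel against the weights `ρ^{1/2}`; cyclicity then
moves `A†` next to `X†`, forming `[A, X]†`. -/
theorem kmsInner_neg_auxGen {n q : ℕ} {ρ : Op n q} (hρ : ρ.PosDef) (A X : Op n q) :
    kmsInner ρ X (-auxGen ρ A X) = kmsInner ρ (A * X - X * A) (A * X - X * A) := by
  set r := matPow ρ (1 / 2) with hr
  set r' := matPow ρ (-(1 / 2)) with hr'
  have h1 : r * r' = 1 := by rw [matPow_add hρ, add_neg_cancel, matPow_zero hρ]
  have h2 : r' * r = 1 := by rw [matPow_add hρ, neg_add_cancel, matPow_zero hρ]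
  set C := A * X - X * A with hC
  have hCt : C.conjTranspose
      = X.conjTranspose * A.conjTranspose - A.conjTranspose * X.conjTranspose := by
    rw [hC, Matrix.conjTranspose_sub, Matrix.conjTranspose_mul, Matrix.conjTranspose_mul]
  have h3 : X.conjTranspose * r * (C * (r * A.conjTranspose * r')) * r
      = X.conjTranspose * r * C * r * A.conjTranspose := by
    simp only [mul_assoc, h2, mul_one]
  have h4 : X.conjTranspose * r * (r' * A.conjTranspose * r * C) * r
      = X.conjTranspose * A.conjTranspose * r * C * r := by
    rw [← mul_assoc _ _ C, ← mul_assoc _ _ r, ← mul_assoc _ r' _, mul_assoc _ r r', h1, mul_one]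
  unfold kmsInner
  rw [auxGen, ← hr, ← hr', ← hC, mul_neg, neg_mul, mul_sub, sub_mul, h3, h4, hCt, sub_mul, sub_mul,
    sub_mul, Matrix.trace_neg, Matrix.trace_sub, Matrix.trace_sub, neg_sub,
    Matrix.trace_mul_comm _ A.conjTranspose]
  simp only [← mul_assoc]

theorem kmsInner_neg_auxGenOn {n q : ℕ} {ρ : Op n q} (hρ : ρ.PosDef) (R : Finset (Fin n))
    (X : Op n q) :
    (kmsInner ρ X (-auxGenOn ρ R X)).re = ∑ i ∈ R, ∑ P : Fin q → Fin 4,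
      kmsNorm ρ (sitePauli i P * X - X * sitePauli i P) ^ 2 := by
  have h : kmsInner ρ X (-auxGenOn ρ R X)
      = ∑ i ∈ R, ∑ P : Fin q → Fin 4, kmsInner ρ X (-auxGen ρ (sitePauli i P) X) := by
    simp [kmsInner, auxGenOn, Matrix.mul_sum, Matrix.sum_mul, Matrix.trace_sum]
  rw [h, Complex.re_sum]
  refine Finset.sum_congr rfl fun i _ => ?_
  rw [Complex.re_sum]
  exact Finset.sum_congr rfl fun P _ => by rw [kmsInner_neg_auxGen hρ, kmsNorm_sq hρ]

/-! ### The conditional gap -/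

/-- A bound for the norm of `ρ^{s} A ρ^{-s}`, `|s| = 1/4`, over the contractions `A` on a site. -/
noncomputable def arakiConst (β : ℝ) : ℝ := Real.exp (2 * (Real.exp (β / 2) - 1))

theorem one_le_arakiConst {β : ℝ} (hβ : 0 ≤ β) : 1 ≤ arakiConst β := by
  have h : 1 ≤ Real.exp (β / 2) := Real.one_le_exp (by positivity)
  exact Real.one_le_exp (by linarith)

open scoped Matrix.Norms.L2Operator in
theorem norm_sitePauli_le {n q : ℕ} (i : Fin n) (P : Fin q → Fin 4) : ‖sitePauli i P‖ ≤ 1 := by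
  have h := Matrix.l2_opNorm_conjTranspose_mul_self (sitePauli i P)
  -- The C*-identity for a Hermitian involution reads `1 = ‖P‖²`.
  rw [sitePauli_isHermitian, sitePauli_mul_self, CStarRing.norm_one] at h
  nlinarith [norm_nonneg (sitePauli i P)]

open scoped Matrix.Norms.L2Operator in
theorem norm_matPow_conj_sitePauli_le {n q : ℕ} {β : ℝ} (hβ : 0 ≤ β) (H : Hamiltonian1D n q)
    (i : Fin n) (P : Fin q → Fin 4) {s : ℝ} (hs : |s| = 1 / 4) :
    ‖matPow (gibbs β H) s * sitePauli i P * matPow (gibbs β H) (-s)‖ ≤ arakiConst β := by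
  refine (norm_matPow_conj_le β H s (siteOp_mem_supportedOn i _)).trans ?_
  rw [abs_mul, abs_of_nonneg hβ, hs, show 2 * (β * (1 / 4)) = β / 2 by ring, ← arakiConst]
  exact mul_le_of_le_one_right (Real.exp_nonneg _) (norm_sitePauli_le i P)

theorem kmsNorm_sitePauli_mul_le {n q : ℕ} {β : ℝ} (hβ : 0 ≤ β) (H : Hamiltonian1D n q)
    (i : Fin n) (P : Fin q → Fin 4) (X : Op n q) :
    kmsNorm (gibbs β H) (sitePauli i P * X) ≤ arakiConst β * kmsNorm (gibbs β H) X := by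
  refine (kmsNorm_mul_le (gibbs_posDef β H) _ X).trans ?_
  exact mul_le_mul_of_nonneg_right
    (norm_matPow_conj_sitePauli_le hβ H i P (by norm_num)) (kmsNorm_nonneg _ _)

theorem kmsNorm_mul_sitePauli_le {n q : ℕ} {β : ℝ} (hβ : 0 ≤ β) (H : Hamiltonian1D n q)
    (i : Fin n) (P : Fin q → Fin 4) (X : Op n q) :
    kmsNorm (gibbs β H) (X * sitePauli i P) ≤ arakiConst β * kmsNorm (gibbs β H) X := by
  refine (kmsNorm_mul_le_right (gibbs_posDef β H) X _).trans ?_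
  rw [mul_comm]
  refine mul_le_mul_of_nonneg_right ?_ (kmsNorm_nonneg _ _)
  have h := norm_matPow_conj_sitePauli_le hβ H i P (s := -(1 / 4)) (by norm_num)
  rwa [neg_neg] at h

/-- The mean over the Pauli strings at the site `i` of the KMS norms of the commutators. -/
noncomputable def meanCommutator {n q : ℕ} (ρ : Op n q) (X : Op n q) (i : Fin n) : ℝ :=
  ((4 : ℝ) ^ q)⁻¹ * ∑ P : Fin q → Fin 4, kmsNorm ρ (sitePauli i P * X - X * sitePauli i P)

theorem meanCommutator_nonneg {n q : ℕ} (ρ X : Op n q) (i : Fin n) :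
    0 ≤ meanCommutator ρ X i :=
  mul_nonneg (by positivity) (Finset.sum_nonneg fun _ _ => kmsNorm_nonneg _ _)

theorem sum_const_pauli (q : ℕ) (x : ℝ) : ∑ _P : Fin q → Fin 4, x = 4 ^ q * x := by
  simp

/-- Cauchy–Schwarz even gives an extra factor `4^{-q}`, which is discarded. -/
theorem meanCommutator_sq_le {n q : ℕ} (ρ X : Op n q) (i : Fin n) :
    meanCommutator ρ X i ^ 2
      ≤ ∑ P : Fin q → Fin 4, kmsNorm ρ (sitePauli i P * X - X * sitePauli i P) ^ 2 := by
  set f : (Fin q → Fin 4) → ℝ := fun P =>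
    kmsNorm ρ (sitePauli i P * X - X * sitePauli i P) with hf
  have h := sq_sum_le_card_mul_sum_sq (s := Finset.univ) (f := f)
  have hc : ((Finset.univ : Finset (Fin q → Fin 4)).card : ℝ) = 4 ^ q := by simp
  rw [hc] at h
  have h0 : 0 ≤ ∑ P, f P ^ 2 := Finset.sum_nonneg fun _ _ => sq_nonneg _
  have h4 : (1 : ℝ) ≤ 4 ^ q := one_le_pow₀ (by norm_num)
  rw [meanCommutator, mul_pow, inv_pow, inv_mul_le_iff₀ (by positivity)]
  refine h.trans (mul_le_mul_of_nonneg_right ?_ h0)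
  exact le_self_pow₀ h4 two_ne_zero

theorem kmsNorm_siteTwirl_le {n q : ℕ} {β : ℝ} (hβ : 0 ≤ β) (H : Hamiltonian1D n q)
    (i : Fin n) (X : Op n q) :
    kmsNorm (gibbs β H) (siteTwirl i X) ≤ arakiConst β ^ 2 * kmsNorm (gibbs β H) X := by
  have hK := one_le_arakiConst hβ
  have h : ∀ P : Fin q → Fin 4, kmsNorm (gibbs β H) (sitePauli i P * X * sitePauli i P)
      ≤ arakiConst β ^ 2 * kmsNorm (gibbs β H) X := fun P => by
    have h1 := kmsNorm_mul_sitePauli_le hβ H i P (sitePauli i P * X)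
    have h2 := mul_le_mul_of_nonneg_left (kmsNorm_sitePauli_mul_le hβ H i P X)
      (zero_le_one.trans hK)
    linarith
  rw [siteTwirl, kmsNorm_smul _ (by positivity), inv_mul_le_iff₀ (by positivity),
    ← sum_const_pauli]
  exact (kmsNorm_sum_le (gibbs_posDef β H) _ _).trans (Finset.sum_le_sum fun P _ => h P)

theorem kmsNorm_sub_siteTwirl_le {n q : ℕ} {β : ℝ} (hβ : 0 ≤ β) (H : Hamiltonian1D n q)
    (i : Fin n) (X : Op n q) :
    kmsNorm (gibbs β H) (X - siteTwirl i X)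
      ≤ arakiConst β * meanCommutator (gibbs β H) X i := by
  have hneg : ∀ Y : Op n q, kmsNorm (gibbs β H) (-Y) = kmsNorm (gibbs β H) Y := fun Y => by
    simp [kmsNorm, kmsInner]
  rw [sub_siteTwirl, kmsNorm_smul _ (by positivity), meanCommutator, mul_left_comm,
    Finset.mul_sum]
  refine mul_le_mul_of_nonneg_left ?_ (by positivity)
  refine (kmsNorm_sum_le (gibbs_posDef β H) _ _).trans (Finset.sum_le_sum fun P _ => ?_)
  rw [← hneg (_ - X * _), neg_sub]
  exact kmsNorm_mul_sitePauli_le hβ H i P _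

theorem exists_supportedOn_near {n q : ℕ} {β : ℝ} (hβ : 0 ≤ β) (H : Hamiltonian1D n q)
    (R : Finset (Fin n)) (X : Op n q) :
    ∃ Y ∈ supportedOn Rᶜ, kmsNorm (gibbs β H) (X - Y)
      ≤ (arakiConst β ^ 2) ^ R.card * ∑ i ∈ R, meanCommutator (gibbs β H) X i := by
  induction R using Finset.induction_on with
  | empty =>
    exact ⟨X, mem_supportedOn_iff_commute.mpr fun j hj => by simp at hj,
      by simp [kmsNorm, kmsInner]⟩
  | insert i R hi ih =>
    obtain ⟨Y, hY, hXY⟩ := ih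
    set K := arakiConst β
    have hK : 1 ≤ K := one_le_arakiConst hβ
    -- The twirl enlarges the region where the approximant is trivial: from `R` to `insert i R`.
    refine ⟨siteTwirl i Y, ?_, ?_⟩
    · rw [Finset.compl_insert]
      exact siteTwirl_mem_supportedOn hY
    -- The first summand costs the commutators at `i`; the second is the old error, amplified by at
    -- most `K²`.
    have hlin : X - siteTwirl i Y = (X - siteTwirl i X) + siteTwirl i (X - Y) := by
      simp only [siteTwirl, Matrix.mul_sub, Matrix.sub_mul, Finset.sum_sub_distrib, smul_sub]
      abel
    have h1 := kmsNorm_sub_siteTwirl_le hβ H i X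
    have h2 := kmsNorm_siteTwirl_le hβ H i (X - Y)
    have h3 := mul_le_mul_of_nonneg_left hXY (sq_nonneg K)
    have hKp : K ≤ (K ^ 2) ^ (R.card + 1) := by
      rw [← pow_mul]
      exact le_self_pow₀ hK (by omega)
    have h4 := mul_le_mul_of_nonneg_right hKp (meanCommutator_nonneg (gibbs β H) X i)
    rw [Finset.card_insert_of_notMem hi, Finset.sum_insert hi, mul_add, hlin]
    calc _ ≤ _ := kmsNorm_add_le (gibbs_posDef β H) _ _
      _ ≤ K * meanCommutator (gibbs β H) X i
          + K ^ 2 * ((K ^ 2) ^ R.card * ∑ i ∈ R, meanCommutator (gibbs β H) X i) :=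
        add_le_add h1 (h2.trans h3)
      _ ≤ _ := by
        rw [pow_succ' (K ^ 2) R.card] at h4 ⊢
        linarith

theorem condVar_le_dirichlet {n q : ℕ} {β : ℝ} (hβ : 0 ≤ β) (H : Hamiltonian1D n q)
    (R : Finset (Fin n)) (X : Op n q) :
    condVar (gibbs_posDef β H) R X ≤ (2 * arakiConst β ^ 4) ^ R.card
      * (kmsInner (gibbs β H) X (-auxGenOn (gibbs β H) R X)).re := by
  obtain ⟨Y, hY, hXY⟩ := exists_supportedOn_near hβ H R X
  set K := arakiConst β
  set d := meanCommutator (gibbs β H) X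
  -- The Cauchy–Schwarz factor `|R|` is absorbed into the exponential.
  have hcard : (R.card : ℝ) ≤ 2 ^ R.card := by exact_mod_cast Nat.lt_two_pow_self.le
  have hsum : ∑ i ∈ R, d i ^ 2
      ≤ (kmsInner (gibbs β H) X (-auxGenOn (gibbs β H) R X)).re := by
    rw [kmsInner_neg_auxGenOn (gibbs_posDef β H)]
    exact Finset.sum_le_sum fun i _ => meanCommutator_sq_le _ X i
  calc condVar (gibbs_posDef β H) R X ≤ kmsNorm (gibbs β H) (X - Y) ^ 2 :=
        condVar_le (gibbs_posDef β H) R X hY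
    _ ≤ ((K ^ 2) ^ R.card * ∑ i ∈ R, d i) ^ 2 := pow_le_pow_left₀ (kmsNorm_nonneg _ _) hXY 2
    _ = (K ^ 4) ^ R.card * (∑ i ∈ R, d i) ^ 2 := by
        rw [mul_pow, ← pow_mul, ← pow_mul, ← pow_mul]
        congr 2
        ring
    _ ≤ (K ^ 4) ^ R.card * (2 ^ R.card * ∑ i ∈ R, d i ^ 2) := by
        have h := sq_sum_le_card_mul_sum_sq (s := R) (f := d)
        gcongr
        exact h.trans (by gcongr)
    _ = (2 * K ^ 4) ^ R.card * ∑ i ∈ R, d i ^ 2 := by rw [mul_pow]; ring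
    _ ≤ _ := by gcongr

end SpinChain

theorem mainTheorem12 (β : ℝ) (hβ : 0 ≤ β) :
    ∃ c : ℝ, 1 ≤ c ∧
      ∀ (n q : ℕ) (H : SpinChain.Hamiltonian1D n q) (R : Finset (Fin n)),
        ((1 / (c * 2 ^ q) ^ R.card : ℝ) : EReal) ≤
          SpinChain.condSpectralGap (SpinChain.gibbs_posDef β H) R := by
  have hK := one_le_pow₀ (SpinChain.one_le_arakiConst hβ) (n := 4)
  refine ⟨2 * SpinChain.arakiConst β ^ 4, by linarith, fun n q H R => ?_⟩
  refine le_iInf₂ fun X hX => EReal.coe_le_coe_iff.mpr ?_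
  have hV : 0 < SpinChain.condVar (SpinChain.gibbs_posDef β H) R X :=
    (sq_nonneg _).lt_of_ne' hX
  have h := SpinChain.condVar_le_dirichlet hβ H R X
  set D := (SpinChain.kmsInner (SpinChain.gibbs β H) X
    (-SpinChain.auxGenOn (SpinChain.gibbs β H) R X)).re
  set c := 2 * SpinChain.arakiConst β ^ 4
  have hc : 0 < c := by linarith
  -- Forced by `0 < Var_R(X) ≤ c^{|R|} D`.
  have hD : 0 ≤ D := by
    by_contra hD
    have := mul_neg_of_pos_of_neg (pow_pos hc R.card) (not_le.mp hD)
    linarith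
  -- The bound already holds with `c^{|R|}`; the factor `2^q ≥ 1` only weakens it.
  have hcq : c ^ R.card ≤ (c * 2 ^ q) ^ R.card := by
    refine pow_le_pow_left₀ hc.le ?_ _
    exact le_mul_of_one_le_right hc.le (one_le_pow₀ (by norm_num))
  rw [div_le_div_iff₀ (by positivity) hV, one_mul]
  calc _ ≤ c ^ R.card * D := h
    _ ≤ (c * 2 ^ q) ^ R.card * D := by gcongr
    _ = _ := mul_comm _ _
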